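/- Let $n>0$ and let $p:\mathbb C\to\mathbb C$ be a complex polynomial of algebraic degree $n$. Then $p$, regarded as a map from $\mathbb R^2$ into itself by identifying $x+iy$ with $(x,y)$, is proper and has Brouwer degree $n$; that is, $\deg(p,\mathbb R^2,y)=n$ for every $y\in\mathbb R^2$. Moreover (Fundamental Theorem of Algebra), there is $z\in\mathbb C$ with $p(z)=0$. Here a continuous map is proper if preimages of compact sets are compact. For $U\subseteq\mathbb R^k$ open, $f$ an $\mathbb R^k$-valued map that is continuous and proper on $\overline U$, and $y\in\mathbb R^k\setminus f(\partial U)$, the Brouwer degree $\deg(f,U,y)$ is defined as follows. If $f$ is $C^\infty$ on $\overline U$ (i.e. extends to a $C^\infty$ map on an open neighbourhood of $\overline U$) and the derivative $f'(x)$ is onto at every $x\in U$ with $f(x)=y$ (the triple $(f,U,y)$ is then called regular), then $$\deg(f,U,y)=\sum_{x\in f^{-1}(y)\cap U}\operatorname{sign}\det f'(x).$$ In general, $\deg(f,U,y)$ is the common value of $\deg(g,U,z)$ over all regular triples $(g,U,z)$ for which there are $\varepsilon,\sigma>0$ with $|f(x)-g(x)|\le\varepsilon$ for all $x\in\overline U$,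 $|y-z|\le\sigma$ and $\varepsilon+\sigma<\operatorname{dist}(y,f(\partial U))$, where $\operatorname{dist}(y,\emptyset)=+\infty$. (That such triples exist and that the value is common to all of them is part of the assertion that the degree equals $n$.) -/

import Mathlib

open scoped ContDiff

namespace BrouwerDegree

/-- `ℝᵏ` with its Euclidean norm. -/
abbrev E (k : ℕ) : Type := EuclideanSpace ℝ (Fin k)

/-- The triple `(f, U, y)` is admissible: `U` is open, `f` is continuous and proper on the closure
of `U` (continuity is part of `IsProperMap`), and `f` does not take the value `y` on `∂U`.
Only the values of `f` on the closure of `U` matter. -/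
structure Admissible {k : ℕ} (f : E k → E k) (U : Set (E k)) (y : E k) : Prop where
  isOpen : IsOpen U
  proper : IsProperMap ((closure U).domRestrict f)
  ne_on_frontier : ∀ x ∈ frontier U, f x ≠ y

/-- `f` is `C^∞` on an arbitrary set `X`: its restriction to `X` admits a `C^∞` extension to an
open neighbourhood of `X`. -/
def SmoothOnSet {k : ℕ} (f : E k → E k) (X : Set (E k)) : Prop :=
  ∃ (V : Set (E k)) (F : E k → E k), IsOpen V ∧ X ⊆ V ∧ ContDiffOn ℝ ∞ F V ∧ Set.EqOn F f X

/-- The triple `(f, U, y)` is regular: it is admissible, `f` is `C^∞` (on the closure of `U`), and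
`y` is a regular value of `f` in `U`, i.e. the derivative of `f` is onto at every solution in `U`
of `f x = y`. -/
structure Regular {k : ℕ} (f : E k → E k) (U : Set (E k)) (y : E k) : Prop
    extends Admissible f U y where
  smooth : SmoothOnSet f (closure U)
  regularValue : ∀ x ∈ U, f x = y → Function.Surjective (fderiv ℝ f x)

/-- The index of `f` at `x`: the sign of the Jacobian determinant. -/
noncomputable def index {k : ℕ} (f : E k → E k) (x : E k) : ℤ :=
  ((SignType.sign (fderiv ℝ f x).det : SignType) : ℤ)

/-- The Brouwer degree of a regular triple, `∑ index f x` over the solutions `x ∈ U` of `f x = y`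
(for a regular triple there are finitely many of them). -/
noncomputable def regularDegree {k : ℕ} (f : E k → E k) (U : Set (E k)) (y : E k) : ℤ :=
  ∑ᶠ x ∈ f ⁻¹' {y} ∩ U, index f x

/-- `(g, U, z)` is a regular triple that approximates `(f, U, y)` well enough to compute its
degree: for some `ε, σ > 0` with `ε + σ < dist (y, f(∂U))`, the map `g` is `ε`-close to `f` on the
closure of `U` and `z` is `σ`-close to `y`. The distance to the empty set is `+∞`. -/
def RegularApprox {k : ℕ} (f : E k → E k) (U : Set (E k)) (y : E k)
    (g : E k → E k) (z : E k) : Prop :=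
  Regular g U z ∧ ∃ ε σ : ℝ, 0 < ε ∧ 0 < σ ∧
    (∀ x ∈ closure U, ‖f x - g x‖ ≤ ε) ∧ ‖y - z‖ ≤ σ ∧
    ENNReal.ofReal (ε + σ) < Metric.infEDist y (f '' frontier U)

/-- `deg (f, U, y)` is defined and equal to `d`: the triple is admissible, it has approximating
regular triples, and all of them have degree `d`. -/
def HasDegreeAt {k : ℕ} (f : E k → E k) (U : Set (E k)) (y : E k) (d : ℤ) : Prop :=
  Admissible f U y ∧ (∃ g z, RegularApprox f U y g z) ∧
    ∀ g z, RegularApprox f U y g z → regularDegree g U z = d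

/-- The value of the degree is unique. -/
theorem HasDegreeAt.unique {k : ℕ} {f : E k → E k} {U : Set (E k)} {y : E k} {d d' : ℤ}
    (h : HasDegreeAt f U y d) (h' : HasDegreeAt f U y d') : d = d' := by
  obtain ⟨g, z, hg⟩ := h.2.1
  exact (h.2.2 g z hg).symm.trans (h'.2.2 g z hg)

/-- The map `f : ℝᵏ → ℝᵏ` is (continuous and) proper and its topological degree
`deg f = deg (f, ℝᵏ, y)`, for whatever `y ∈ ℝᵏ`, is `d`. -/
def HasDegree {k : ℕ} (f : E k → E k) (d : ℤ) : Prop :=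
  IsProperMap f ∧ ∀ y : E k, HasDegreeAt f Set.univ y d

/-- A map `ℂ → ℂ` regarded as a map of the plane `ℝ²` into itself, `x + iy` being identified with
`(x, y)`. -/
noncomputable def planeMap (h : ℂ → ℂ) (v : E 2) : E 2 :=
  !₂[(h ⟨v 0, v 1⟩).re, (h ⟨v 0, v 1⟩).im]

end BrouwerDegree

namespace BrouwerDegree

open Filter Topology Bornology ComplexConjugate

/-! Since `∂ℝ²` is empty, the competing regular triples are all smooth `g` at bounded distance from
`p`, with any regular value `z`. Boundedness makes `f = g - z` turn `n` times along large circles,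
so it suffices that the signed count of simple zeros equals the turning number at infinity
(`sum_localTurn_eq`).

This is an induction on the zeros. Near a zero `x` of sign `s`, `f` looks like a multiple of `z - x`
or its conjugate. Dividing by that factor and patching in a small disc (`exists_divide_out`) removes
`x` and lowers the turning number by `s` (`TurnsAtInfinity.div_spin`). Once no zeros remain, a
continuous logarithm on `ℂ` forces turning number `0` (`TurnsAtInfinity.eq_zero_of_ne_zero`). -/

/-- The identity of `ℂ` for positive `s`, complex conjugation otherwise. -/
noncomputable def spin (s : ℤ) (w : ℂ) : ℂ := if 0 < s then w else conj w

@[simp] lemma norm_spin (s : ℤ) (w : ℂ) : ‖spin s w‖ = ‖w‖ := by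
  unfold spin; split_ifs <;> simp

@[simp] lemma spin_zero (s : ℤ) : spin s 0 = 0 := by
  unfold spin; split_ifs <;> simp

lemma spin_ne_zero (s : ℤ) {w : ℂ} (hw : w ≠ 0) : spin s w ≠ 0 := by
  rw [← norm_ne_zero_iff, norm_spin]; exact norm_ne_zero_iff.2 hw

lemma continuous_spin (s : ℤ) : Continuous (spin s) := by
  unfold spin; split_ifs
  · exact continuous_id
  · exact Complex.continuous_conj

/-- Near `x`, the map `f` is a small perturbation of a nonzero multiple of `z ↦ z - x` or of its
conjugate, according to the sign of `s`. -/
def LocalTurn (f : ℂ → ℂ) (x : ℂ) (s : ℤ) : Prop :=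
  ∃ a : ℂ, a ≠ 0 ∧ ∃ ρ : ℝ, ρ < 1 ∧
    ∀ᶠ z in 𝓝 x, ‖f z - a * spin s (z - x)‖ ≤ ρ * ‖a‖ * ‖z - x‖

/-- Near infinity, `f` behaves as a multiple of `z ↦ ‖z‖ ^ k * (z / ‖z‖) ^ N`. -/
def TurnsAtInfinity (f : ℂ → ℂ) (N : ℤ) : Prop :=
  ∃ c : ℂ, c ≠ 0 ∧ ∃ k : ℤ,
    Tendsto (fun z : ℂ => f z / ((‖z‖ : ℂ) ^ k * (z / ‖z‖) ^ N)) (cobounded ℂ) (𝓝 c)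

/-! ### Simple zeros and how to divide them out -/

lemma LocalTurn.eq_zero {f : ℂ → ℂ} {x : ℂ} {s : ℤ} (h : LocalTurn f x s) : f x = 0 := by
  obtain ⟨a, -, ρ, -, h⟩ := h
  simpa using h.self_of_nhds

/-- Near `x`, `u` is `u x` up to `o(1)`, and the gap between `ρ` and `1` absorbs that error. This
preserves the other zeros when one is divided out. -/
lemma LocalTurn.mul {f u g : ℂ → ℂ} {x : ℂ} {s : ℤ} (h : LocalTurn f x s)
    (hu : ContinuousAt u x) (hux : u x ≠ 0) (hg : ∀ᶠ z in 𝓝 x, g z = f z * u z) :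
    LocalTurn g x s := by
  obtain ⟨a, ha, ρ, hρ, h⟩ := h
  refine ⟨a * u x, mul_ne_zero ha hux, (ρ + 1) / 2, by linarith, ?_⟩
  have hpos : 0 < ‖u x‖ := norm_pos_iff.2 hux
  have hlim : Tendsto (fun z => ρ * ‖u z‖ + ‖u z - u x‖) (𝓝 x)
      (𝓝 (ρ * ‖u x‖ + ‖u x - u x‖)) :=
    (hu.norm.const_mul ρ).add (hu.sub continuousAt_const).norm
  have hlt : ρ * ‖u x‖ + ‖u x - u x‖ < (ρ + 1) / 2 * ‖u x‖ := by
    rw [sub_self, norm_zero, add_zero]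
    exact mul_lt_mul_of_pos_right (by linarith) hpos
  filter_upwards [h, hg, hlim.eventually_lt_const hlt] with z hz hgz hlz
  have e : g z - a * u x * spin s (z - x) =
      (f z - a * spin s (z - x)) * u z + a * spin s (z - x) * (u z - u x) := by
    rw [hgz]; ring
  calc ‖g z - a * u x * spin s (z - x)‖
      ≤ ‖f z - a * spin s (z - x)‖ * ‖u z‖ + ‖a‖ * ‖z - x‖ * ‖u z - u x‖ := by
        rw [e]
        refine (norm_add_le _ _).trans (le_of_eq ?_)
        simp only [norm_mul, norm_spin]
    _ ≤ ρ * ‖a‖ * ‖z - x‖ * ‖u z‖ + ‖a‖ * ‖z - x‖ * ‖u z - u x‖ := by gcongr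
    _ = (ρ * ‖u z‖ + ‖u z - u x‖) * (‖a‖ * ‖z - x‖) := by ring
    _ ≤ ((ρ + 1) / 2 * ‖u x‖) * (‖a‖ * ‖z - x‖) := by gcongr
    _ = (ρ + 1) / 2 * ‖a * u x‖ * ‖z - x‖ := by rw [norm_mul]; ring

/-- A simple zero can be divided out, after a modification in a small disc around it. -/
lemma exists_divide_out {f : ℂ → ℂ} (hf : Continuous f) {x : ℂ} {s : ℤ} (hx : LocalTurn f x s) :
    ∃ g : ℂ → ℂ, Continuous g ∧ (∀ z, g z = 0 → f z = 0 ∧ z ≠ x) ∧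
      (∀ y, y ≠ x → f y = 0 → ∀ᶠ z in 𝓝 y, g z = f z / spin s (z - x)) ∧
      ∀ᶠ z in cobounded ℂ, g z = f z / spin s (z - x) := by
  obtain ⟨a, ha, ρ, hρ, h⟩ := hx
  obtain ⟨r, hr, hball⟩ := Metric.eventually_nhds_iff.1 h
  have hapos : 0 < ‖a‖ := norm_pos_iff.2 ha
  set F : ℂ → ℂ := fun z => f z / spin s (z - x) with hF
  -- On the punctured disc the quotient stays in the open disc of radius `‖a‖` about `a`, which
  -- omits `0`.
  have hFa : ∀ z, z ≠ x → dist z x < r → ‖F z - a‖ < ‖a‖ := by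
    intro z hzx hz
    have hne : z - x ≠ 0 := sub_ne_zero.2 hzx
    have hs := spin_ne_zero s hne
    have e : F z - a = (f z - a * spin s (z - x)) / spin s (z - x) := by
      simp only [hF]; field_simp
    rw [e, norm_div, norm_spin, div_lt_iff₀ (norm_pos_iff.2 hne)]
    refine (hball hz).trans_lt ?_
    have : 0 < ‖a‖ * ‖z - x‖ := mul_pos hapos (norm_pos_iff.2 hne)
    nlinarith
  have hFc : ∀ z, z ≠ x → ContinuousAt F z := fun z hzx =>
    hf.continuousAt.div ((continuous_spin s).comp (continuous_id.sub continuous_const)).continuousAt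
      (spin_ne_zero s (sub_ne_zero.2 hzx))
  set χ : ℂ → ℝ := fun z => max 0 (min 1 (2 - 4 * dist z x / r)) with hχ
  have hχc : Continuous χ := by fun_prop
  have hχ0 : ∀ z, 0 ≤ χ z := fun z => le_max_left _ _
  have hχ1 : ∀ z, χ z ≤ 1 := fun z => max_le zero_le_one (min_le_left _ _)
  have hχin : ∀ z, dist z x < r / 4 → χ z = 1 := by
    intro z hz
    have : 4 * dist z x / r ≤ 1 := by rw [div_le_one hr]; linarith
    simp only [hχ]
    rw [min_eq_left (by linarith), max_eq_right zero_le_one]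
  have hχout : ∀ z, r / 2 < dist z x → χ z = 0 := by
    intro z hz
    have : 2 ≤ 4 * dist z x / r := by rw [le_div_iff₀ hr]; linarith
    simp only [hχ]
    exact max_eq_left ((min_le_right _ _).trans (by linarith))
  -- Interpolating between `F` and the constant `a` stays in that convex disc, so no new zero
  -- appears; `g` is `a` near `x` and `F` farther out.
  set g : ℂ → ℂ := fun z => (1 - χ z : ℝ) * F z + (χ z : ℝ) * a with hg
  have hgout : ∀ z, r / 2 < dist z x → g z = F z := by
    intro z hz; simp [hg, hχout z hz]
  refine ⟨g, continuous_iff_continuousAt.2 fun z => ?_, fun z hz => ?_, fun y hyx hy => ?_, ?_⟩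
  · by_cases hzx : z = x
    · subst hzx
      refine (continuousAt_const (y := a)).congr ?_
      filter_upwards [Metric.ball_mem_nhds z (by positivity : 0 < r / 4)] with w hw
      simp [hg, hχin w hw]
    · refine ContinuousAt.add (ContinuousAt.mul ?_ (hFc z hzx)) ?_ <;> fun_prop
  · have hzx : z ≠ x := by
      rintro rfl
      have : χ z = 1 := hχin z (by simpa using hr)
      simp [hg, this, ha] at hz
    refine ⟨?_, hzx⟩
    by_cases hd : dist z x < r
    · exfalso
      have e : g z - a = (1 - χ z : ℝ) * (F z - a) := by simp only [hg]; push_cast; ring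
      have h1 := hFa z hzx hd
      have h2 : ‖g z - a‖ ≤ ‖F z - a‖ := by
        rw [e, norm_mul, Complex.norm_real, Real.norm_of_nonneg (by linarith [hχ1 z])]
        exact mul_le_of_le_one_left (norm_nonneg _) (by linarith [hχ0 z])
      rw [hz, zero_sub, norm_neg] at h2
      linarith
    · rw [hgout z (by linarith)] at hz
      exact (div_eq_zero_iff.1 hz).resolve_right (spin_ne_zero s (sub_ne_zero.2 hzx))
  · have hd : r / 2 < dist y x := by
      by_contra! hd
      have := hFa y hyx (by linarith)
      simp [hF, hy] at this
    filter_upwards [(isOpen_lt continuous_const (continuous_id.dist continuous_const)).mem_nhds hd]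
      with z hz using hgout z hz
  · filter_upwards [isBounded_def.1 (Metric.isBounded_closedBall (x := x) (r := r / 2))] with z hz
    exact hgout z (by simpa using hz)

/-! ### Turning number at infinity -/

lemma tendsto_sub_div_self_cobounded (x : ℂ) :
    Tendsto (fun z : ℂ => (z - x) / z) (cobounded ℂ) (𝓝 1) := by
  have h : Tendsto (fun z : ℂ => 1 - x * z⁻¹) (cobounded ℂ) (𝓝 (1 - x * 0)) :=
    tendsto_const_nhds.sub (tendsto_inv₀_cobounded.const_mul x)
  rw [mul_zero, sub_zero] at h
  refine h.congr' ?_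
  filter_upwards [eventually_ne_cobounded (0 : ℂ)] with z hz
  field_simp

/-- At infinity `spin s (z - x)` is asymptotic to `spin s z = ‖z‖ * (z / ‖z‖) ^ s`, so division
lowers `k` by `1` and `N` by `s`. -/
lemma TurnsAtInfinity.div_spin {f g : ℂ → ℂ} {N s : ℤ} (h : TurnsAtInfinity f N)
    (hs : s = 1 ∨ s = -1) (x : ℂ) (hg : ∀ᶠ z in cobounded ℂ, g z = f z / spin s (z - x)) :
    TurnsAtInfinity g (N - s) := by
  obtain ⟨c, hc, k, h⟩ := h
  refine ⟨c, hc, k - 1, ?_⟩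
  have hlim : Tendsto (fun z : ℂ => spin s ((z - x) / z)) (cobounded ℂ) (𝓝 1) := by
    have := ((continuous_spin s).tendsto 1).comp (tendsto_sub_div_self_cobounded x)
    have h1 : spin s 1 = 1 := by unfold spin; split_ifs <;> simp
    rwa [h1] at this
  have := h.div hlim one_ne_zero
  rw [div_one] at this
  refine this.congr' ?_
  filter_upwards [hg, eventually_ne_cobounded (0 : ℂ), eventually_ne_cobounded x] with z hz hz0 hzx
  have hn : (‖z‖ : ℂ) ≠ 0 := by simpa using hz0
  have hsub : z - x ≠ 0 := sub_ne_zero.2 hzx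
  have hu : z / ‖z‖ ≠ 0 := div_ne_zero hz0 hn
  have key : spin s z = ‖z‖ * (z / ‖z‖) ^ s := by
    rcases hs with rfl | rfl
    · simp [spin]; field_simp
    · have := Complex.mul_conj' z
      simp only [spin, Int.reduceNeg, Left.neg_pos_iff, not_lt.2 zero_le_one, if_false, zpow_neg,
        zpow_one, inv_div]
      field_simp
      rw [mul_comm, this]
  have hdiv : spin s ((z - x) / z) = spin s (z - x) / spin s z := by
    unfold spin; split_ifs <;> simp
  have h1 := spin_ne_zero s hsub
  have h2 := spin_ne_zero s hz0
  have hus : (z / ‖z‖) ^ s ≠ 0 := zpow_ne_zero _ hu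
  have huN : (z / ‖z‖) ^ N ≠ 0 := zpow_ne_zero _ hu
  have hnk : (‖z‖ : ℂ) ^ k ≠ 0 := zpow_ne_zero _ hn
  rw [Pi.div_apply, hz, hdiv, zpow_sub₀ hn, zpow_sub₀ hu, zpow_one, key]
  generalize (z / (‖z‖ : ℂ)) ^ s = A at *
  generalize (z / (‖z‖ : ℂ)) ^ N = B at *
  field_simp

/-- A zero-free map on the simply connected `ℂ` lifts through `exp`. Its logarithm returns to its
initial value around a large circle, whereas turning `N` times would change it by `2πiN`. -/
lemma TurnsAtInfinity.eq_zero_of_ne_zero {f : ℂ → ℂ} {N : ℤ} (h : TurnsAtInfinity f N)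
    (hf : Continuous f) (h0 : ∀ z, f z ≠ 0) : N = 0 := by
  obtain ⟨c, hc, k, h⟩ := h
  obtain ⟨G, hGc, hG⟩ : ∃ G : ℂ → ℂ, Continuous G ∧ ∀ z, Complex.exp (G z) = f z := by
    obtain ⟨⟨G, hGc⟩, ⟨-, hG⟩, -⟩ := Complex.isCoveringMapOn_exp.existsUnique_continuousMap_lifts
      (⟨f, hf⟩ : C(ℂ, ℂ)) (a₀ := 0) (Complex.exp_log (h0 0)) h0
    exact ⟨G, hGc, congrFun hG⟩
  -- Neighbourhoods of infinity are pulled back along the norm, so the estimate holds on an entire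
  -- circle of some radius `R > 0`.
  have hball := h.eventually (Metric.ball_mem_nhds c (norm_pos_iff.2 hc))
  rw [← comap_norm_atTop, eventually_comap] at hball
  obtain ⟨R, hR, hR0⟩ := (hball.and (eventually_gt_atTop 0)).exists
  set w : ℝ → ℂ := fun θ => R * Complex.exp (θ * Complex.I) with hw
  have hwc : Continuous w := by fun_prop
  have hwn : ∀ θ, ‖w θ‖ = R := by
    intro θ; simp [hw, Complex.norm_exp_ofReal_mul_I, abs_of_pos hR0]
  have hRC : (R : ℂ) ≠ 0 := by exact_mod_cast hR0.ne'
  have hwu : ∀ θ, w θ / R = Complex.exp (θ * Complex.I) := by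
    intro θ; simp only [hw]; field_simp
  set q : ℝ → ℂ := fun θ => f (w θ) / ((R : ℂ) ^ k * Complex.exp (θ * Complex.I) ^ N) / c with hq
  have hden : ∀ θ : ℝ, (R : ℂ) ^ k * Complex.exp (θ * Complex.I) ^ N ≠ 0 := fun θ =>
    mul_ne_zero (zpow_ne_zero _ hRC) (zpow_ne_zero _ (Complex.exp_ne_zero _))
  have hqc : Continuous q := by
    refine ((hf.comp hwc).div (continuous_const.mul (Continuous.zpow₀ (by fun_prop) N
      fun θ => Or.inl (Complex.exp_ne_zero _))) hden).div_const c
  have hqs : ∀ θ, q θ ∈ Complex.slitPlane := by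
    intro θ
    have hb := hR (w θ) (hwn θ)
    rw [hwn, hwu, dist_eq_norm] at hb
    suffices h : ‖q θ - 1‖ < 1 by simpa using Complex.mem_slitPlane_of_norm_lt_one h
    have e : q θ - 1 = (f (w θ) / ((R : ℂ) ^ k * Complex.exp (θ * Complex.I) ^ N) - c) / c := by
      simp only [hq]; rw [sub_div, div_self hc]
    rw [e, norm_div, div_lt_one (norm_pos_iff.2 hc)]
    exact hb
  -- On the circle, `f = R ^ k * c * exp (iNθ) * q` with `q` within `1` of `1`. Hence `H` is a
  -- continuous logarithm of the constant `R ^ k * c`, and is constant by uniqueness of lifts.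
  set H : ℝ → ℂ := fun θ => G (w θ) - N * (θ * Complex.I) - Complex.log (q θ) with hH
  have hHc : Continuous H :=
    ((hGc.comp hwc).sub (by fun_prop)).sub (hqc.clog hqs)
  have hHe : ∀ θ, Complex.exp (H θ) = (R : ℂ) ^ k * c := by
    intro θ
    have hq0 := Complex.slitPlane_ne_zero (hqs θ)
    simp only [hH]
    rw [Complex.exp_sub, Complex.exp_sub, hG, Complex.exp_log hq0, Complex.exp_int_mul]
    have := hden θ
    have h1 : Complex.exp (θ * Complex.I) ^ N ≠ 0 := zpow_ne_zero _ (Complex.exp_ne_zero _)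
    have h2 := h0 (w θ)
    have h3 : (R : ℂ) ^ k ≠ 0 := zpow_ne_zero _ hRC
    simp only [hq]
    field_simp
  have hconst : H (2 * Real.pi) = H 0 := by
    have hcov := Complex.isCoveringMapOn_exp.existsUnique_continuousMap_lifts
      (⟨fun _ => (R : ℂ) ^ k * c, continuous_const⟩ : C(ℝ, ℂ)) (a₀ := 0) (e₀ := H 0) (hHe 0)
      (fun _ => mul_ne_zero (zpow_ne_zero _ hRC) hc)
    have := hcov.unique (y₁ := ⟨H, hHc⟩) (y₂ := ⟨fun _ => H 0, continuous_const⟩)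
      ⟨rfl, funext hHe⟩ ⟨rfl, funext fun _ => hHe 0⟩
    exact DFunLike.congr_fun this (2 * Real.pi)
  have hw2 : w (2 * Real.pi) = w 0 := by simp [hw]
  have hq2 : q (2 * Real.pi) = q 0 := by simp [hq, hw2]
  simp only [hH, hw2, hq2] at hconst
  have : (N : ℂ) * (2 * Real.pi * Complex.I) = 0 := by
    push_cast at hconst
    linear_combination -hconst
  simpa [Real.pi_ne_zero] using this

theorem sum_localTurn_eq {S : Finset ℂ} {s : ℂ → ℤ} : ∀ {f : ℂ → ℂ} {N : ℤ}, Continuous f →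
    (∀ x ∈ S, (s x = 1 ∨ s x = -1) ∧ LocalTurn f x (s x)) → (∀ z, f z = 0 → z ∈ S) →
    TurnsAtInfinity f N → ∑ x ∈ S, s x = N := by
  classical
  induction S using Finset.induction_on with
  | empty =>
    intro f N hf _ h0 hN
    simpa using (hN.eq_zero_of_ne_zero hf fun z hz => by simpa using h0 z hz).symm
  | insert x S hxS ih =>
    intro f N hf hS h0 hN
    obtain ⟨hsx, hx⟩ := hS x (Finset.mem_insert_self x S)
    obtain ⟨g, hg, hg0, hgy, hginf⟩ := exists_divide_out hf hx
    have := ih (N := N - s x) hg (fun y hy => ?_) (fun z hz => ?_) (hN.div_spin hsx x hginf)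
    · rw [Finset.sum_insert hxS, this]; ring
    · obtain ⟨hsy, hfy⟩ := hS y (Finset.mem_insert_of_mem hy)
      have hyx : y ≠ x := fun h => hxS (h ▸ hy)
      have hne := spin_ne_zero (s x) (sub_ne_zero.2 hyx)
      refine ⟨hsy, hfy.mul (u := fun z => (spin (s x) (z - x))⁻¹) ?_ (inv_ne_zero hne) ?_⟩
      · exact ((continuous_spin _).comp
          (continuous_id.sub continuous_const)).continuousAt.inv₀ hne
      · simpa only [div_eq_mul_inv] using hgy y hyx hfy.eq_zero
    · obtain ⟨h1, h2⟩ := hg0 z hz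
      exact (Finset.mem_insert.1 (h0 z h1)).resolve_left h2

/-! ### Regular zeros and the sign of the Jacobian -/

/-- The Wirtinger decomposition: the sign of the determinant tells whether the holomorphic or the
antiholomorphic part dominates. -/
lemma exists_eq_mul_add_mul_conj (L : ℂ →L[ℝ] ℂ) : ∃ a b : ℂ,
    (∀ w, L w = a * w + b * conj w) ∧ L.det = ‖a‖ ^ 2 - ‖b‖ ^ 2 := by
  refine ⟨(L 1 - Complex.I * L Complex.I) / 2, (L 1 + Complex.I * L Complex.I) / 2,
    fun w => ?_, ?_⟩
  · have h : L w = w.re * L 1 + w.im * L Complex.I := by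
      conv_lhs => rw [show w = w.re • (1 : ℂ) + w.im • Complex.I by simp [Complex.re_add_im]]
      rw [map_add, map_smul, map_smul, Complex.real_smul, Complex.real_smul]
    rw [h]
    have h1 : w = w.re + w.im * Complex.I := (Complex.re_add_im w).symm
    have h2 : conj w = w.re - w.im * Complex.I := by
      apply Complex.ext <;> simp
    rw [h2]
    conv_rhs => rw [h1]
    simp only [Complex.add_re, Complex.ofReal_re, Complex.mul_re, Complex.I_re, mul_zero,
      Complex.ofReal_im, Complex.I_im, mul_one, sub_self, add_zero, Complex.add_im, Complex.mul_im,
      zero_add]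
    linear_combination ((w.im : ℂ) * L Complex.I) * Complex.I_mul_I
  · rw [ContinuousLinearMap.det, ← LinearMap.det_toMatrix Complex.basisOneI, Matrix.det_fin_two]
    simp only [LinearMap.toMatrix_apply, Complex.coe_basisOneI, Complex.coe_basisOneI_repr,
      ← Complex.normSq_eq_norm_sq, Complex.normSq_apply]
    simp
    ring

lemma localTurn_of_hasFDerivAt {f : ℂ → ℂ} {L : ℂ →L[ℝ] ℂ} {x : ℂ} (hL : HasFDerivAt f L x)
    (hx : f x = 0) (hdet : L.det ≠ 0) : LocalTurn f x ((SignType.sign L.det : SignType) : ℤ) := by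
  suffices h : ∃ a b : ℂ, ‖b‖ < ‖a‖ ∧ ∀ w, ‖L w - a * spin (SignType.sign L.det : SignType) w‖
      ≤ ‖b‖ * ‖w‖ by
    obtain ⟨a, b, hab, h⟩ := h
    have ha : 0 < ‖a‖ := (norm_nonneg b).trans_lt hab
    -- The subordinate part costs `‖b‖` and the remainder of the derivative half of the gap `‖a‖ -
    -- ‖b‖`; their sum is `(‖a‖ + ‖b‖) / 2`.
    refine ⟨a, norm_pos_iff.1 ha, (‖a‖ + ‖b‖) / (2 * ‖a‖), ?_, ?_⟩
    · rw [div_lt_one (by positivity)]; linarith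
    · have hlo := hL.isLittleO.def (c := (‖a‖ - ‖b‖) / 2) (by linarith)
      filter_upwards [hlo] with z hz
      rw [hx, sub_zero] at hz
      calc ‖f z - a * spin (SignType.sign L.det : SignType) (z - x)‖
          ≤ ‖f z - L (z - x)‖ + ‖L (z - x) - a * spin (SignType.sign L.det : SignType) (z - x)‖ :=
            norm_sub_le_norm_sub_add_norm_sub _ _ _
        _ ≤ (‖a‖ - ‖b‖) / 2 * ‖z - x‖ + ‖b‖ * ‖z - x‖ := add_le_add hz (h _)
        _ = (‖a‖ + ‖b‖) / (2 * ‖a‖) * ‖a‖ * ‖z - x‖ := by field_simp; ring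
  obtain ⟨a, b, hLab, hd⟩ := exists_eq_mul_add_mul_conj L
  rcases lt_or_gt_of_ne hdet with hneg | hpos
  · refine ⟨b, a, ?_, fun w => ?_⟩
    · exact lt_of_pow_lt_pow_left₀ 2 (norm_nonneg _) (by linarith)
    · simp [sign_neg hneg, spin, hLab]
  · refine ⟨a, b, ?_, fun w => ?_⟩
    · exact lt_of_pow_lt_pow_left₀ 2 (norm_nonneg _) (by linarith)
    · simp [sign_pos hpos, spin, hLab]

lemma LocalTurn.eventually_ne_zero {f : ℂ → ℂ} {x : ℂ} {s : ℤ} (h : LocalTurn f x s) :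
    ∀ᶠ z in 𝓝[≠] x, f z ≠ 0 := by
  obtain ⟨a, ha, ρ, hρ, h⟩ := h
  filter_upwards [nhdsWithin_le_nhds h, self_mem_nhdsWithin] with z hz hzx hf
  have hpos : 0 < ‖a‖ * ‖z - x‖ :=
    mul_pos (norm_pos_iff.2 ha) (norm_pos_iff.2 (sub_ne_zero.2 hzx))
  rw [hf, zero_sub, norm_neg, norm_mul, norm_spin] at hz
  nlinarith

lemma TurnsAtInfinity.isBounded_zeros {f : ℂ → ℂ} {N : ℤ} (h : TurnsAtInfinity f N) :
    IsBounded {z | f z = 0} := by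
  obtain ⟨c, hc, k, h⟩ := h
  rw [isBounded_def]
  filter_upwards [h.eventually_ne hc] with z hz hf
  exact hz (by rw [show f z = 0 from hf, zero_div])

/-- The signed count of the zeros of a plane map with simple zeros is its turning number at
infinity. -/
theorem finsum_sign_det_eq {f : ℂ → ℂ} {N : ℤ} (hf : Differentiable ℝ f)
    (hN : TurnsAtInfinity f N) (hreg : ∀ z, f z = 0 → (fderiv ℝ f z).det ≠ 0) :
    ∑ᶠ z ∈ {z | f z = 0}, ((SignType.sign (fderiv ℝ f z).det : SignType) : ℤ) = N := by
  have hturn : ∀ z, f z = 0 →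
      LocalTurn f z ((SignType.sign (fderiv ℝ f z).det : SignType) : ℤ) := fun z hz =>
    localTurn_of_hasFDerivAt (hf z).hasFDerivAt hz (hreg z hz)
  -- The zeros form a compact set, and each is isolated because it is simple.
  have hfin : {z | f z = 0}.Finite := by
    by_contra hinf
    have hcpt : IsCompact {z | f z = 0} := Metric.isCompact_of_isClosed_isBounded
      (isClosed_eq hf.continuous continuous_const) hN.isBounded_zeros
    obtain ⟨x, hx, hacc⟩ := Set.Infinite.exists_accPt_of_subset_isCompact hinf hcpt subset_rfl
    exact (accPt_iff_frequently_nhdsNE.1 hacc) ((hturn x hx).eventually_ne_zero)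
  rw [finsum_mem_eq_finite_toFinset_sum _ hfin]
  refine sum_localTurn_eq hf.continuous (fun x hx => ?_) (fun z hz => by simpa using hz) hN
  have hx0 : f x = 0 := by simpa using hx
  refine ⟨?_, hturn x hx0⟩
  rcases lt_or_gt_of_ne (hreg x hx0) with h | h
  · right; simp [sign_neg h]
  · left; simp [sign_pos h]

/-! ### Bounded perturbations of polynomials -/

/-- A bounded error is negligible against `z ^ n` because `n > 0`, and `z ^ n` is the model with `k
= N = n`. -/
lemma turnsAtInfinity_of_norm_sub_le {p : Polynomial ℂ} (hp : 0 < p.natDegree) {f : ℂ → ℂ} {C : ℝ}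
    (hf : ∀ z, ‖f z - p.eval z‖ ≤ C) : TurnsAtInfinity f p.natDegree := by
  have hlc : p.leadingCoeff ≠ 0 := by
    rw [Polynomial.leadingCoeff_ne_zero]; rintro rfl; simp at hp
  refine ⟨p.leadingCoeff, hlc, p.natDegree, ?_⟩
  have h1 : Tendsto (fun z : ℂ => p.leadingCoeff * (p.eval z / (p.leadingCoeff * z ^ p.natDegree)))
      (cobounded ℂ) (𝓝 (p.leadingCoeff * 1)) := by
    refine Tendsto.const_mul _ ((Asymptotics.isEquivalent_iff_tendsto_one ?_).1
      (Polynomial.isEquivalent_cobounded_leading_monomial (P := p)))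
    filter_upwards [eventually_ne_cobounded (0 : ℂ)] with z hz
    exact mul_ne_zero hlc (pow_ne_zero _ hz)
  have h2 : Tendsto (fun z : ℂ => (z ^ p.natDegree)⁻¹ * (f z - p.eval z)) (cobounded ℂ) (𝓝 0) := by
    have h0 : Tendsto (fun z : ℂ => (z ^ p.natDegree)⁻¹) (cobounded ℂ) (𝓝 0) := by
      have := (tendsto_inv₀_cobounded (α := ℂ)).pow p.natDegree
      simpa [zero_pow hp.ne'] using this
    exact h0.zero_mul_isBoundedUnder_le
      ⟨C, eventually_map.2 (Eventually.of_forall fun z => by simpa using hf z)⟩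
  have h := h1.add h2
  rw [mul_one, add_zero] at h
  refine h.congr' ?_
  filter_upwards [eventually_ne_cobounded (0 : ℂ)] with z hz
  have hn : (‖z‖ : ℂ) ≠ 0 := by simpa using hz
  have : (‖z‖ : ℂ) ^ (p.natDegree : ℤ) * (z / ‖z‖) ^ (p.natDegree : ℤ) = z ^ p.natDegree := by
    rw [← mul_zpow, mul_div_cancel₀ _ hn, zpow_natCast]
  rw [this]
  have := pow_ne_zero p.natDegree hz
  field_simp
  ring

/-! ### Transfer to the plane and the degree -/

/-- The identification of the plane with `ℂ`. -/
noncomputable def toComplex : E 2 ≃L[ℝ] ℂ :=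
  Complex.orthonormalBasisOneI.repr.symm.toContinuousLinearEquiv

lemma norm_toComplex (v : E 2) : ‖toComplex v‖ = ‖v‖ :=
  Complex.orthonormalBasisOneI.repr.symm.norm_map v

lemma planeMap_eq (h : ℂ → ℂ) : planeMap h = toComplex.symm ∘ h ∘ toComplex := by
  funext v
  have hv : toComplex v = ⟨v 0, v 1⟩ := by
    refine (Complex.orthonormalBasisOneI_repr_symm_apply v).trans ?_
    apply Complex.ext <;> simp
  have hs : ∀ z : ℂ, toComplex.symm z = !₂[z.re, z.im] := by
    intro z
    ext i
    exact congrFun (Complex.orthonormalBasisOneI_repr_apply z) i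
  simp only [Function.comp_apply, hv, hs, planeMap]

/-- A smooth plane map at bounded distance from a polynomial has the degree of the polynomial at
each regular value. -/
theorem regularDegree_eq_natDegree {p : Polynomial ℂ} (hp : 0 < p.natDegree) {g : E 2 → E 2}
    (hg : Differentiable ℝ g) {C : ℝ} (hgp : ∀ v, ‖planeMap (fun z => p.eval z) v - g v‖ ≤ C)
    {z : E 2} (hreg : ∀ v, g v = z → Function.Surjective (fderiv ℝ g v)) :
    regularDegree g Set.univ z = p.natDegree := by
  set f : ℂ → ℂ := fun w => toComplex (g (toComplex.symm w) - z) with hfdef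
  have hderiv : ∀ w, HasFDerivAt f ((toComplex : E 2 →L[ℝ] ℂ) ∘L
      fderiv ℝ g (toComplex.symm w) ∘L (toComplex.symm : ℂ →L[ℝ] E 2)) w := fun w =>
    toComplex.hasFDerivAt.comp w
      (((hg _).hasFDerivAt.comp w toComplex.symm.hasFDerivAt).sub_const z)
  have hdet : ∀ w, (fderiv ℝ f w).det = (fderiv ℝ g (toComplex.symm w)).det := by
    intro w
    rw [(hderiv w).fderiv]
    exact LinearMap.det_conj (fderiv ℝ g (toComplex.symm w) : E 2 →ₗ[ℝ] E 2)
      toComplex.toLinearEquiv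
  have hzero : ∀ w, f w = 0 ↔ g (toComplex.symm w) = z := by
    intro w; simp [hfdef, sub_eq_zero]
  have hturn : TurnsAtInfinity f p.natDegree := by
    -- Subtracting the target value `z` costs a further bounded error `‖z‖`.
    refine turnsAtInfinity_of_norm_sub_le hp (C := C + ‖z‖) fun w => ?_
    have e : f w - p.eval w = toComplex
        (-(planeMap (fun z => p.eval z) (toComplex.symm w) - g (toComplex.symm w)) - z) := by
      simp only [hfdef, planeMap_eq, Function.comp_apply, map_sub, map_neg,
        ContinuousLinearEquiv.apply_symm_apply]
      ring
    rw [e, norm_toComplex]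
    refine (norm_sub_le _ _).trans ?_
    rw [norm_neg]
    gcongr
    exact hgp _
  rw [← finsum_sign_det_eq (fun w => (hderiv w).differentiableAt) hturn fun w hw => ?_]
  · refine finsum_mem_eq_of_bijOn toComplex ⟨fun v hv => ?_, toComplex.injective.injOn,
      fun w hw => ⟨toComplex.symm w, ?_, by simp⟩⟩ fun v hv => ?_
    · exact (hzero _).2 (by simpa using hv)
    · exact ⟨(hzero w).1 hw, trivial⟩
    · simp only [index, hdet, ContinuousLinearEquiv.symm_apply_apply]
  · rw [hdet]
    have hs := hreg _ ((hzero w).1 hw)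
    have hb : LinearMap.ker (fderiv ℝ g (toComplex.symm w) : E 2 →ₗ[ℝ] E 2) = ⊥ :=
      LinearMap.ker_eq_bot.2 (LinearMap.injective_iff_surjective.2 hs)
    exact fun h0 => (LinearMap.bot_lt_ker_of_det_eq_zero h0).ne' hb

lemma SmoothOnSet.contDiff {k : ℕ} {g : E k → E k} (h : SmoothOnSet g Set.univ) :
    ContDiff ℝ ∞ g := by
  obtain ⟨V, F, -, hV, hF, hFg⟩ := h
  rw [← contDiffOn_univ]
  exact (hF.mono hV).congr fun x hx => (hFg hx).symm

lemma admissible_univ {k : ℕ} {f : E k → E k} (hf : IsProperMap f) (y : E k) :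
    Admissible f Set.univ y where
  isOpen := isOpen_univ
  proper := hf.comp isClosed_closure.isClosedEmbedding_subtypeVal.isProperMap
  ne_on_frontier := by simp

lemma isProperMap_planeMap_eval {p : Polynomial ℂ} (hp : 0 < p.natDegree) :
    IsProperMap (planeMap fun z => p.eval z) := by
  rw [planeMap_eq]
  exact toComplex.symm.toHomeomorph.isProperMap.comp
    ((p.isProperMap_eval (Polynomial.natDegree_pos_iff_degree_pos.1 hp)).comp
      toComplex.toHomeomorph.isProperMap)

/-- Critical values are images of the finitely many roots of `p'`, so some value avoids them; over
it the derivative is multiplication by a nonzero complex number. -/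
lemma exists_regular_planeMap_eval {p : Polynomial ℂ} (hp : 0 < p.natDegree) :
    ∃ z, Regular (planeMap fun z => p.eval z) Set.univ z := by
  have hd : p.derivative ≠ 0 := fun h =>
    hp.ne' (Polynomial.derivative_eq_zero.1 h)
  obtain ⟨w, hw⟩ := (((Polynomial.finite_setOfPred_isRoot hd).image fun z => p.eval z)).exists_notMem
  have hderiv : ∀ v, HasFDerivAt (planeMap fun z => p.eval z)
      ((toComplex.symm : ℂ →L[ℝ] E 2) ∘L
        ((ContinuousLinearMap.toSpanSingleton ℂ (p.derivative.eval (toComplex v))).restrictScalars ℝ)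
        ∘L (toComplex : E 2 →L[ℝ] ℂ)) v := by
    intro v
    rw [planeMap_eq]
    exact toComplex.symm.hasFDerivAt.comp v
      (((p.hasDerivAt _).hasFDerivAt.restrictScalars ℝ).comp v toComplex.hasFDerivAt)
  refine ⟨toComplex.symm w, admissible_univ (isProperMap_planeMap_eval hp) _, ?_, fun v _ hv => ?_⟩
  · refine ⟨Set.univ, _, isOpen_univ, Set.subset_univ _, contDiffOn_univ.2 ?_, fun _ _ => rfl⟩
    rw [planeMap_eq]
    exact toComplex.symm.contDiff.comp
      ((Polynomial.contDiff_aeval p ∞).restrict_scalars ℝ |>.comp toComplex.contDiff)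
  · have hne : p.derivative.eval (toComplex v) ≠ 0 := by
      intro h0
      refine hw ⟨toComplex v, h0, ?_⟩
      rw [planeMap_eq] at hv
      exact toComplex.symm.injective hv
    rw [(hderiv v).fderiv]
    intro u
    refine ⟨toComplex.symm (toComplex u / p.derivative.eval (toComplex v)), ?_⟩
    simp [hne]

theorem hasDegree_planeMap_eval {p : Polynomial ℂ} (hp : 0 < p.natDegree) :
    HasDegree (planeMap fun z => p.eval z) p.natDegree := by
  have hproper := isProperMap_planeMap_eval hp
  refine ⟨hproper, fun y => ⟨admissible_univ hproper y, ?_, ?_⟩⟩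
  · obtain ⟨z, hz⟩ := exists_regular_planeMap_eval hp
    -- The frontier is empty, so any `ε` and `σ` are small enough; the `+ 1` keeps `σ` positive when
    -- `y = z`.
    refine ⟨_, z, hz, 1, ‖y - z‖ + 1, one_pos, by positivity, by simp, by linarith, ?_⟩
    simp
  · rintro g z ⟨hg, ε, σ, -, -, hgε, -, -⟩
    have hsm : ContDiff ℝ ∞ g := SmoothOnSet.contDiff (by simpa using hg.smooth)
    exact regularDegree_eq_natDegree hp (hsm.differentiable (by simp))
      (fun v => hgε v (by simp)) fun v hv => hg.regularValue v trivial hv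

end BrouwerDegree

theorem mainTheorem6 (n : ℕ) (hn : 0 < n) (p : Polynomial ℂ) (hp : p.natDegree = n) :
    IsProperMap (BrouwerDegree.planeMap fun z => p.eval z) ∧
      BrouwerDegree.HasDegree (BrouwerDegree.planeMap fun z => p.eval z) (n : ℤ) ∧
      ∃ z : ℂ, p.eval z = 0 := by
  subst hp
  -- The root comes from `Complex.exists_root`, not from the nonvanishing of the degree.
  exact ⟨BrouwerDegree.isProperMap_planeMap_eval hn, BrouwerDegree.hasDegree_planeMap_eval hn,
    Complex.exists_root (Polynomial.natDegree_pos_iff_degree_pos.1 hn)⟩
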